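/- Let $k$ be a field with $\operatorname{char} k\neq 2$, let $A=k\langle X,Y\rangle/(X^2,\,XY+YX,\,Y^2)$ (the quantum complete intersection with $a=2$, $q=-1$), and write $x,y$ for the classes of $X,Y$. Let $A^e=A\otimes_k A^{\mathrm{op}}$ be the enveloping algebra and let $\mathrm{HH}^*(A)=\bigoplus_{n\ge 0}\operatorname{Ext}^n_{A^e}(A,A)$ be the Hochschild cohomology algebra with the Yoneda product; its even part is $\mathrm{HH}^{2*}(A)=\bigoplus_{t\ge 0}\mathrm{HH}^{2t}(A)$. Put $\alpha_x=1\otimes x-x\otimes 1$, $\beta_x=1\otimes x+x\otimes 1$, $\alpha_y=1\otimes y-y\otimes 1$, $\beta_y=1\otimes y+y\otimes 1$ in $A^e$. Let $P_n=\bigoplus_{i=0}^n A^e f_i^n$ be free of rank $n+1$, with $$d_n(f_i^n)=\begin{cases}(-1)^i(\beta_y f_i^{n-1}+\beta_x f_{i-1}^{n-1}) & n \text{ even},\\ (-1)^i(\alpha_y f_i^{n-1}-\alpha_x f_{i-1}^{n-1}) & n\text{ odd}\end{cases}$$ for $n\ge 1$ (where $f_{-1}^{n}=f_{n+1}^{n}=0$);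 together with $\mu:P_0\to A$, $f_0^0\mapsto 1$, this is a projective resolution of $A$ over $A^e$. For $t\ge 0$ and $0\le i\le 2t$ let $\xi_i^{2t}\in\mathrm{HH}^{2t}(A)$ be the class of the cocycle $P_{2t}\to A$, $f_j^{2t}\mapsto\delta_{ij}\cdot 1_A$. (The superscript is the cohomological degree, not a power.) Let $R$ be the $k$-subalgebra of $\mathrm{HH}^{*}(A)$ generated by all $\xi_i^{2t}$ with $t\ge 0$, $0\le i\le 2t$. Then: 1. $R$ is contained in $\mathrm{HH}^{2*}(A)$. 2. $R=R_0\oplus R_1$ is a $\mathbb{Z}_2$-graded $k$-algebra, where $R_0$ (respectively $R_1$) is the $k$-linear span of the $\xi_i^{2t}$ with $i$ even (respectively odd). Moreover, $R_0$ is also the $k$-subalgebra generated by the $\xi_i^{2t}$ with $i$ even. 3. There is an isomorphism of $k$-algebras from the polynomial ring $k[z_0,z_1]$ to $R_0$ with $z_0\mapsto\xi_0^2$ and $z_1\mapsto\xi_2^2$. 4. $R_1=R_0\cdot\xi_1^2$, and $\xi_1^2\cdot\xi_1^2=\xi_2^4$. -/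

import Mathlib

open CategoryTheory Abelian DirectSum TensorProduct

universe u

noncomputable section

namespace HochschildCohomology

section ExtAlgebra

variable {k : Type u} [Field k] {C : Type (u + 1)} [Category.{u} C] [Abelian C] [HasExt.{u} C]

instance extGOne (X : C) : GradedMonoid.GOne (fun n : ℕ => Ext X X n) where
  one := Ext.mk₀ (𝟙 X)

/-- The Yoneda product `x • y`: first `x`, then `y`. -/
instance extGMul (X : C) : GradedMonoid.GMul (fun n : ℕ => Ext X X n) where
  mul x y := x.comp y rfl

lemma ext_mk_mul_mk {X : C} {m n l : ℕ} (h : m + n = l) (x : Ext X X m) (y : Ext X X n) :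
    (GradedMonoid.mk m x * GradedMonoid.mk n y : GradedMonoid fun n => Ext X X n) =
      GradedMonoid.mk l (x.comp y h) := by
  subst h; rfl

lemma ext_one_mul {X : C} (x : GradedMonoid fun n : ℕ => Ext X X n) : 1 * x = x := by
  cases x with
  | mk n x =>
    calc
      _ = GradedMonoid.mk 0 (Ext.mk₀ (𝟙 X)) * GradedMonoid.mk n x := rfl
      _ = GradedMonoid.mk n ((Ext.mk₀ (𝟙 X)).comp x (zero_add n)) := ext_mk_mul_mk _ _ _
      _ = GradedMonoid.mk n x := congrArg _ (Ext.mk₀_id_comp x)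

lemma ext_mul_one {X : C} (x : GradedMonoid fun n : ℕ => Ext X X n) : x * 1 = x := by
  cases x with
  | mk n x =>
    calc
      _ = GradedMonoid.mk n x * GradedMonoid.mk 0 (Ext.mk₀ (𝟙 X)) := rfl
      _ = GradedMonoid.mk n (x.comp (Ext.mk₀ (𝟙 X)) (add_zero n)) := ext_mk_mul_mk _ _ _
      _ = GradedMonoid.mk n x := congrArg _ (Ext.comp_mk₀_id x)

lemma ext_mul_assoc {X : C} (x y z : GradedMonoid fun n : ℕ => Ext X X n) :
    x * y * z = x * (y * z) := by
  obtain ⟨l, x⟩ := x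
  obtain ⟨m, y⟩ := y
  obtain ⟨n, z⟩ := z
  calc
    _ = GradedMonoid.mk (l + m) (x.comp y rfl) * GradedMonoid.mk n z := rfl
    _ = GradedMonoid.mk (l + (m + n)) ((x.comp y rfl).comp z (add_assoc l m n)) :=
      ext_mk_mul_mk _ _ _
    _ = GradedMonoid.mk (l + (m + n)) (x.comp (y.comp z rfl) rfl) :=
      congrArg _ (Ext.comp_assoc x y z rfl rfl (add_assoc l m n))
    _ = _ := rfl

instance extGMonoid (X : C) : GradedMonoid.GMonoid (fun n : ℕ => Ext X X n) where
  one_mul := ext_one_mul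
  mul_one := ext_mul_one
  mul_assoc := ext_mul_assoc

/-- The graded ring structure given by the Yoneda product on the groups `Ext X X n`. -/
instance extGRing (X : C) : DirectSum.GRing (fun n : ℕ => Ext X X n) where
  mul_zero x := Ext.comp_zero x X _ _ rfl
  zero_mul y := Ext.zero_comp X _ y _ rfl
  mul_add x y z := Ext.comp_add x y z rfl
  add_mul x y z := Ext.add_comp x y z rfl
  natCast n := n • Ext.mk₀ (𝟙 X)
  natCast_zero := zero_nsmul _
  natCast_succ _ := succ_nsmul _ _
  intCast n := n • Ext.mk₀ (𝟙 X)
  intCast_ofNat _ := natCast_zsmul _ _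
  intCast_negSucc_ofNat _ := negSucc_zsmul _ _

/-- The scalar `c` as the class of `c • 𝟙`. -/
def extScalar [Linear k C] (X : C) : k →+ Ext X X 0 where
  toFun c := c • Ext.mk₀ (𝟙 X)
  map_zero' := zero_smul _ _
  map_add' _ _ := add_smul _ _ _

lemma extScalar_apply [Linear k C] (X : C) (c : k) :
    extScalar X c = c • Ext.mk₀ (𝟙 X) := rfl

lemma extScalar_one [Linear k C] (X : C) : extScalar X (1 : k) = Ext.mk₀ (𝟙 X) := by
  rw [extScalar_apply, one_smul]

lemma extScalar_mul [Linear k C] {X : C} (c : k) {n : ℕ} (x : Ext X X n) :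
    (GradedMonoid.mk 0 (extScalar X c) * GradedMonoid.mk n x : GradedMonoid fun n => Ext X X n) =
      GradedMonoid.mk n (c • x) := by
  rw [ext_mk_mul_mk (zero_add n), extScalar_apply, Ext.smul_comp, Ext.mk₀_id_comp]

lemma mul_extScalar [Linear k C] {X : C} (c : k) {n : ℕ} (x : Ext X X n) :
    (GradedMonoid.mk n x * GradedMonoid.mk 0 (extScalar X c) : GradedMonoid fun n => Ext X X n) =
      GradedMonoid.mk n (c • x) := by
  rw [ext_mk_mul_mk (add_zero n), extScalar_apply, Ext.comp_smul, Ext.comp_mk₀_id]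

/-- The `k`-algebra structure: scalars act through `c • 𝟙`. -/
instance extGAlgebra [Linear k C] (X : C) :
    DirectSum.GAlgebra k (fun n : ℕ => Ext X X n) where
  toFun := extScalar X
  map_one :=
    calc
      _ = Ext.mk₀ (𝟙 X) := extScalar_one X
      _ = _ := rfl
  map_mul r s :=
    calc
      _ = GradedMonoid.mk 0 (r • extScalar X s) := by
        rw [extScalar_apply, extScalar_apply, mul_smul]
      _ = GradedMonoid.mk 0 (extScalar X r) * GradedMonoid.mk 0 (extScalar X s) :=
        (extScalar_mul r (extScalar X s)).symm
      _ = _ := rfl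
  commutes r x := by
    cases x with
    | mk n x =>
      calc
        _ = GradedMonoid.mk 0 (extScalar X r) * GradedMonoid.mk n x := rfl
        _ = GradedMonoid.mk n x * GradedMonoid.mk 0 (extScalar X r) :=
          (extScalar_mul r x).trans (mul_extScalar r x).symm
        _ = _ := rfl
  smul_def r x := by
    cases x with
    | mk n x =>
      calc
        _ = GradedMonoid.mk n (r • x) := rfl
        _ = GradedMonoid.mk 0 (extScalar X r) * GradedMonoid.mk n x :=
          (extScalar_mul r x).symm
        _ = _ := rfl

end ExtAlgebra

section Bimodules

variable (k : Type u) [Field k] (B : Type u) [Ring B] [Algebra k B]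

/-- The enveloping algebra `B ⊗ Bᵒᵖ`. -/
def Env : Type u := B ⊗[k] Bᵐᵒᵖ

instance : Ring (Env k B) := inferInstanceAs (Ring (B ⊗[k] Bᵐᵒᵖ))

instance : Algebra k (Env k B) := inferInstanceAs (Algebra k (B ⊗[k] Bᵐᵒᵖ))

/-- `B` as a left module over its enveloping algebra. -/
instance envModule : Module (Env k B) B :=
  letI m : Module (B ⊗[k] Bᵐᵒᵖ) B := TensorProduct.Algebra.module
  m

variable {B}

/-- The element `b ⊗ c` of the enveloping algebra. -/
def env (b c : B) : Env k B := b ⊗ₜ[k] MulOpposite.op c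

lemma env_smul (b c m : B) : env k b c • m = b * m * c :=
  (TensorProduct.Algebra.smul_def b (MulOpposite.op c) m).trans (mul_assoc b m c).symm

lemma env_mul (b c b' c' : B) : env k b c * env k b' c' = env k (b * b') (c' * c) :=
  Algebra.TensorProduct.tmul_mul_tmul b b' (MulOpposite.op c) (MulOpposite.op c')

lemma env_zero_left (c : B) : env k 0 c = 0 := TensorProduct.zero_tmul _ _

lemma env_zero_right (b : B) : env k b 0 = 0 := TensorProduct.tmul_zero _ _

lemma env_add_left (b b' c : B) : env k (b + b') c = env k b c + env k b' c :=
  TensorProduct.add_tmul b b' (MulOpposite.op c)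

lemma env_add_right (b c c' : B) : env k b (c + c') = env k b c + env k b c' :=
  TensorProduct.tmul_add b (MulOpposite.op c) (MulOpposite.op c')

lemma env_neg_left (b c : B) : env k (-b) c = -env k b c :=
  TensorProduct.neg_tmul b (MulOpposite.op c)

lemma env_neg_right (b c : B) : env k b (-c) = -env k b c :=
  TensorProduct.tmul_neg b (MulOpposite.op c)

lemma env_smul_left (r : k) (b c : B) : env k (r • b) c = r • env k b c :=
  TensorProduct.smul_tmul' r b (MulOpposite.op c)

lemma env_smul_right (r : k) (b c : B) : env k b (r • c) = r • env k b c :=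
  TensorProduct.tmul_smul r b (MulOpposite.op c)

lemma env_induction {p : Env k B → Prop} (tmul : ∀ b c, p (env k b c))
    (add : ∀ u v, p u → p v → p (u + v)) (u : Env k B) : p u :=
  TensorProduct.induction_on u (by simpa [env] using! tmul 0 0)
    (fun b c => tmul b c.unop) add

/-- A linear endomorphism of `B` acts on the left tensor factor. -/
def envMap (f : B →ₗ[k] B) : Env k B →ₗ[k] Env k B := f.rTensor Bᵐᵒᵖ

lemma envMap_env (f : B →ₗ[k] B) (b c : B) : envMap k f (env k b c) = env k (f b) c := rfl

variable (B)

/-- The `B`-bimodule `B`. -/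
abbrev bimod : ModuleCat.{u} (Env k B) := ModuleCat.of (Env k B) B

/-- The Hochschild cohomology `HH^*(B) = Ext^*_{Bᵉ}(B, B)` with the Yoneda product. -/
abbrev HH : Type u := ⨁ n : ℕ, Ext (bimod k B) (bimod k B) n

/-- The even part `HH^{2*}(B)`, the sum of the groups `HH^{2t}(B)`. -/
def HHEven : Submodule k (HH k B) :=
  ⨆ t : ℕ, LinearMap.range
    (DirectSum.lof k ℕ (fun n : ℕ => Ext (bimod k B) (bimod k B) n) (2 * t))

end Bimodules

section QuantumCompleteIntersection

/-- The relations `X^a = 0`, `XY - qYX = 0`, `Y^a = 0` in `k⟨X, Y⟩`. -/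
inductive QCIRel (k : Type u) [Field k] (a : ℕ) (q : k) :
    FreeAlgebra k (Fin 2) → FreeAlgebra k (Fin 2) → Prop
  | x_pow : QCIRel k a q (FreeAlgebra.ι k 0 ^ a) 0
  | comm : QCIRel k a q (FreeAlgebra.ι k 0 * FreeAlgebra.ι k 1 -
      q • (FreeAlgebra.ι k 1 * FreeAlgebra.ι k 0)) 0
  | y_pow : QCIRel k a q (FreeAlgebra.ι k 1 ^ a) 0

/-- The quantum complete intersection `k⟨X, Y⟩ / (X^a, XY - qYX, Y^a)`. -/
def QCI (k : Type u) [Field k] (a : ℕ) (q : k) : Type u := RingQuot (QCIRel k a q)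

instance (k : Type u) [Field k] (a : ℕ) (q : k) : Ring (QCI k a q) :=
  inferInstanceAs (Ring (RingQuot (QCIRel k a q)))

instance (k : Type u) [Field k] (a : ℕ) (q : k) : Algebra k (QCI k a q) :=
  inferInstanceAs (Algebra k (RingQuot (QCIRel k a q)))

/-- The quotient map `k⟨X, Y⟩ → k⟨X, Y⟩ / (X^a, XY - qYX, Y^a)`. -/
def QCI.mk (k : Type u) [Field k] (a : ℕ) (q : k) : FreeAlgebra k (Fin 2) →ₐ[k] QCI k a q :=
  RingQuot.mkAlgHom k (QCIRel k a q)

lemma QCI.mk_surjective (k : Type u) [Field k] (a : ℕ) (q : k) :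
    Function.Surjective (QCI.mk k a q) :=
  RingQuot.mkAlgHom_surjective k (QCIRel k a q)

lemma QCI.mk_rel {k : Type u} [Field k] {a : ℕ} {q : k} {u v : FreeAlgebra k (Fin 2)}
    (h : QCIRel k a q u v) : QCI.mk k a q u = QCI.mk k a q v :=
  RingQuot.mkAlgHom_rel k h

/-- The algebra map out of a quantum complete intersection given by a map that respects the
relations. -/
def QCI.lift {k : Type u} [Field k] {a : ℕ} {q : k} {S : Type*} [Ring S] [Algebra k S]
    (f : FreeAlgebra k (Fin 2) →ₐ[k] S) (hf : ∀ ⦃u v⦄, QCIRel k a q u v → f u = f v) :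
    QCI k a q →ₐ[k] S :=
  RingQuot.liftAlgHom k ⟨f, hf⟩

lemma QCI.lift_mk {k : Type u} [Field k] {a : ℕ} {q : k} {S : Type*} [Ring S] [Algebra k S]
    (f : FreeAlgebra k (Fin 2) →ₐ[k] S) (hf : ∀ ⦃u v⦄, QCIRel k a q u v → f u = f v)
    (w : FreeAlgebra k (Fin 2)) : QCI.lift f hf (QCI.mk k a q w) = f w :=
  RingQuot.liftAlgHom_mkAlgHom_apply k f hf w

end QuantumCompleteIntersection

variable (k : Type u) [Field k]

/-- The algebra `A = k⟨X, Y⟩ / (X², XY + YX, Y²)`. -/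
abbrev Alg : Type u := QCI k 2 (-1)

/-- The class of `X` in `A`. -/
def x : Alg k := QCI.mk k 2 (-1) (FreeAlgebra.ι k 0)

/-- The class of `Y` in `A`. -/
def y : Alg k := QCI.mk k 2 (-1) (FreeAlgebra.ι k 1)

lemma x_mul_x : x k * x k = 0 := by
  have h := QCI.mk_rel (QCIRel.x_pow (k := k) (a := 2) (q := -1))
  rwa [map_zero, sq, map_mul] at h

lemma y_mul_y : y k * y k = 0 := by
  have h := QCI.mk_rel (QCIRel.y_pow (k := k) (a := 2) (q := -1))
  rwa [map_zero, sq, map_mul] at h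

lemma x_mul_y : x k * y k = -(y k * x k) := by
  have h := QCI.mk_rel (QCIRel.comm (k := k) (a := 2) (q := -1))
  rw [map_zero, map_sub, map_smul, map_mul, map_mul, neg_one_smul, sub_neg_eq_add] at h
  exact eq_neg_of_add_eq_zero_left h

lemma alg_induction {p : Alg k → Prop} (one : p 1) (add : ∀ a b, p a → p b → p (a + b))
    (smul : ∀ (c : k) a, p a → p (c • a)) (mx : ∀ a, p a → p (a * x k))
    (my : ∀ a, p a → p (a * y k)) (a : Alg k) : p a := by
  obtain ⟨w, rfl⟩ := QCI.mk_surjective k 2 (-1) a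
  suffices h : ∀ b, p b → p (b * QCI.mk k 2 (-1) w) by
    simpa using h 1 one
  induction w using FreeAlgebra.induction with
  | grade0 r =>
    intro b hb
    rw [AlgHom.commutes, ← Algebra.commutes, ← Algebra.smul_def]
    exact smul r b hb
  | grade1 i =>
    intro b hb
    fin_cases i
    · exact mx b hb
    · exact my b hb
  | mul u v hu hv =>
    intro b hb
    rw [map_mul, ← mul_assoc]
    exact hv _ (hu b hb)
  | add u v hu hv =>
    intro b hb
    rw [map_add, mul_add]
    exact add _ _ (hu b hb) (hv b hb)

section SkewDerivations

/-- The matrices `(a, δ(a); 0, σ(a))`, where `σ` is the sign automorphism and `δ` the skew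
derivation with `δ(x) = u`, `δ(y) = v`. -/
def skewHom (u v : k) : Alg k →ₐ[k] Matrix (Fin 2) (Fin 2) (Alg k) :=
  QCI.lift (FreeAlgebra.lift k
    ![!![x k, u • 1; 0, -x k], !![y k, v • 1; 0, -y k]]) (by
    intro a b h
    induction h with
    | x_pow =>
      ext i j
      fin_cases i <;> fin_cases j <;> simp [sq, x_mul_x]
    | comm =>
      ext i j
      fin_cases i <;> fin_cases j <;> simp [x_mul_y]
    | y_pow =>
      ext i j
      fin_cases i <;> fin_cases j <;> simp [sq, y_mul_y])

lemma skewHom_x (u v : k) : skewHom k u v (x k) = !![x k, u • 1; 0, -x k] := by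
  simp [skewHom, x, QCI.lift_mk]

lemma skewHom_y (u v : k) : skewHom k u v (y k) = !![y k, v • 1; 0, -y k] := by
  simp [skewHom, y, QCI.lift_mk]

lemma skewHom_zero_zero (u v : k) (a : Alg k) : skewHom k u v a 0 0 = a := by
  induction a using alg_induction with
  | one => simp
  | add a b ha hb => simp [ha, hb]
  | smul c a ha => simp [ha]
  | mx a ha => simp [skewHom_x, ha, Matrix.mul_apply]
  | my a ha => simp [skewHom_y, ha, Matrix.mul_apply]

/-- The skew derivation of `A` that sends `x` to `u` and `y` to `v`. -/
def skewDer (u v : k) : Alg k →ₗ[k] Alg k where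
  toFun a := skewHom k u v a 0 1
  map_add' a b := by simp
  map_smul' c a := by simp

lemma skewDer_one (u v : k) : skewDer k u v 1 = 0 := by
  simp [skewDer]

lemma skewDer_mul_x (u v : k) (a : Alg k) :
    skewDer k u v (a * x k) = u • a - skewDer k u v a * x k := by
  simp [skewDer, Matrix.mul_apply, skewHom_x, skewHom_zero_zero,
    sub_eq_add_neg]

lemma skewDer_mul_y (u v : k) (a : Alg k) :
    skewDer k u v (a * y k) = v • a - skewDer k u v a * y k := by
  simp [skewDer, Matrix.mul_apply, skewHom_y, skewHom_zero_zero,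
    sub_eq_add_neg]

lemma skewDer_sq (u v : k) (a : Alg k) : skewDer k u v (skewDer k u v a) = 0 := by
  induction a using alg_induction with
  | one => simp [skewDer_one]
  | add a b ha hb => simp [ha, hb]
  | smul c a ha => simp [ha]
  | mx a ha => simp [skewDer_mul_x, ha]
  | my a ha => simp [skewDer_mul_y, ha]

lemma skewDer_anticomm (u v u' v' : k) (a : Alg k) :
    skewDer k u v (skewDer k u' v' a) + skewDer k u' v' (skewDer k u v a) = 0 := by
  induction a using alg_induction with
  | one => simp [skewDer_one]
  | add a b ha hb => 
    simp only [map_add]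
    rw [add_add_add_comm, ha, hb, add_zero]
  | smul c a ha => simp only [map_smul, ← smul_add, ha, smul_zero]
  | mx a ha =>
    have h := congrArg (· * x k) ha
    simp only [add_mul, zero_mul] at h
    simp only [skewDer_mul_x, map_sub, map_smul]
    rw [← h]; abel
  | my a ha =>
    have h := congrArg (· * y k) ha
    simp only [add_mul, zero_mul] at h
    simp only [skewDer_mul_y, map_sub, map_smul]
    rw [← h]; abel

lemma skewDer_decomp (a : Alg k) : ∃ c : k,
    a = c • 1 + skewDer k 1 0 a * x k + skewDer k 0 1 (a - skewDer k 1 0 a * x k) * y k := by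
  induction a using alg_induction with
  | one => exact ⟨1, by simp [skewDer_one]⟩
  | add a b ha hb =>
    obtain ⟨c, hc⟩ := ha
    obtain ⟨d, hd⟩ := hb
    refine ⟨c + d, ?_⟩
    nth_rewrite 1 [hc, hd]
    simp only [map_add, map_sub, add_mul, sub_mul, add_smul]
    abel
  | smul r a ha =>
    obtain ⟨c, hc⟩ := ha
    refine ⟨r * c, ?_⟩
    nth_rewrite 1 [hc]
    simp only [map_smul, map_sub, smul_add, smul_sub, smul_mul_assoc, sub_mul, mul_smul]
  | mx a ha =>
    refine ⟨0, ?_⟩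
    simp [skewDer_mul_x, sub_mul, mul_assoc, x_mul_x]
  | my a ha =>
    refine ⟨0, ?_⟩
    have h : skewDer k 1 0 (a * y k) * x k = skewDer k 1 0 a * x k * y k := by
      rw [skewDer_mul_y, zero_smul, zero_sub, neg_mul, mul_assoc, mul_assoc, x_mul_y, mul_neg]
    rw [h, ← sub_mul, skewDer_mul_y, one_smul, sub_mul (a - _), mul_assoc (skewDer k 0 1 _),
      y_mul_y, mul_zero, sub_zero, zero_smul, zero_add, sub_mul, add_sub_cancel]

end SkewDerivations

section Resolution

/-- The enveloping algebra of `A`. -/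
abbrev AEnv : Type u := Env k (Alg k)

/-- The element `x ⊗ 1` of the enveloping algebra. -/
def xl : AEnv k := env k (x k) 1

/-- The element `1 ⊗ x` of the enveloping algebra. -/
def xr : AEnv k := env k 1 (x k)

/-- The element `y ⊗ 1` of the enveloping algebra. -/
def yl : AEnv k := env k (y k) 1

/-- The element `1 ⊗ y` of the enveloping algebra. -/
def yr : AEnv k := env k 1 (y k)

/-- `α_x = 1 ⊗ x - x ⊗ 1` -/
def alphaX : AEnv k := xr k - xl k

/-- `α_y = 1 ⊗ y - y ⊗ 1` -/
def alphaY : AEnv k := yr k - yl k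

/-- `β_x = 1 ⊗ x + x ⊗ 1` -/
def betaX : AEnv k := xr k + xl k

/-- `β_y = 1 ⊗ y + y ⊗ 1` -/
def betaY : AEnv k := yr k + yl k

/-- The free module `P_n` of rank `n + 1` over the enveloping algebra. -/
abbrev P (n : ℕ) : Type u := Fin (n + 1) → AEnv k

/-- The generator `f_i^n` of `P_n`; it is `0` unless `0 ≤ i ≤ n`. -/
def gen (n : ℕ) (i : ℤ) : P k n := fun l => if (l : ℤ) = i then 1 else 0

/-- The differential `d_{n+1} : P_{n+1} → P_n`, where `d_m(f_i^m)` is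
`(-1)^i (β_y f_i^{m-1} + β_x f_{i-1}^{m-1})` for even `m` and
`(-1)^i (α_y f_i^{m-1} - α_x f_{i-1}^{m-1})` for odd `m`. -/
def diff (n : ℕ) : P k (n + 1) →ₗ[AEnv k] P k n :=
  Fintype.linearCombination (AEnv k) fun i : Fin (n + 2) =>
    if Even (n + 1) then
      (-1 : AEnv k) ^ (i : ℕ) • (betaY k • gen k n i + betaX k • gen k n (i - 1))
    else
      (-1 : AEnv k) ^ (i : ℕ) • (alphaY k • gen k n i - alphaX k • gen k n (i - 1))

/-- The augmentation `μ : P_0 → A`, `f_0^0 ↦ 1`. -/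
def aug : P k 0 →ₗ[AEnv k] Alg k :=
  Fintype.linearCombination (AEnv k) fun _ : Fin 1 => (1 : Alg k)

lemma sum_gen {n : ℕ} (p : P k (n + 1)) (c : AEnv k) (e : Fin (n + 2) → AEnv k)
    (l : Fin (n + 1)) :
    ∑ i : Fin (n + 2), p i * (e i * (c * gen k n i l)) = p l.castSucc * (e l.castSucc * c) := by
  rw [Finset.sum_eq_single l.castSucc]
  · simp [gen]
  · intro i _ hi
    have : (l : ℤ) ≠ (i : ℤ) := by
      intro h
      apply hi
      ext
      simpa using (Int.natCast_inj.1 h).symm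
    simp [gen, this]
  · simp

lemma sum_gen_sub_one {n : ℕ} (p : P k (n + 1)) (c : AEnv k) (e : Fin (n + 2) → AEnv k)
    (l : Fin (n + 1)) :
    ∑ i : Fin (n + 2), p i * (e i * (c * gen k n (i - 1) l)) = p l.succ * (e l.succ * c) := by
  rw [Finset.sum_eq_single l.succ]
  · simp [gen]
  · intro i _ hi
    have : (l : ℤ) ≠ (i : ℤ) - 1 := by
      intro h
      apply hi
      ext
      simp
      omega
    simp [gen, this]
  · simp

lemma neg_one_pow_mul_comm (m : ℕ) (a : AEnv k) : a * (-1) ^ m = (-1) ^ m * a :=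
  ((Commute.neg_one_left a).pow_left m).symm

lemma diff_apply (n : ℕ) (p : P k (n + 1)) (l : Fin (n + 1)) :
    diff k n p l = (-1) ^ (l : ℕ) * (p l.castSucc * (yr k + (-1) ^ (n + 1) * yl k) -
      p l.succ * (xl k + (-1) ^ (n + 1) * xr k)) := by
  rcases Nat.even_or_odd (n + 1) with h | h
  · simp only [diff, Fintype.linearCombination_apply, if_pos h, Finset.sum_apply, Pi.smul_apply,
      Pi.add_apply, smul_eq_mul, mul_add, Finset.sum_add_distrib]
    rw [sum_gen, sum_gen_sub_one]
    simp only [← mul_assoc, neg_one_pow_mul_comm, betaX, betaY, Fin.val_succ, Fin.val_castSucc,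
      h.neg_one_pow, pow_succ _ (l : ℕ)]
    noncomm_ring
  · have h' : ¬ Even (n + 1) := Nat.not_even_iff_odd.2 h
    simp only [diff, Fintype.linearCombination_apply, if_neg h', Finset.sum_apply, Pi.smul_apply,
      Pi.sub_apply, smul_eq_mul, mul_sub, Finset.sum_sub_distrib]
    rw [sum_gen, sum_gen_sub_one]
    simp only [← mul_assoc, neg_one_pow_mul_comm, alphaX, alphaY, Fin.val_succ, Fin.val_castSucc,
      h.neg_one_pow, pow_succ _ (l : ℕ)]
    noncomm_ring

lemma xl_mul_xl : xl k * xl k = 0 := by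
  simp [xl, env_mul, x_mul_x, env_zero_left]

lemma yl_mul_yl : yl k * yl k = 0 := by
  simp [yl, env_mul, y_mul_y, env_zero_left]

lemma xr_mul_xr : xr k * xr k = 0 := by
  simp [xr, env_mul, x_mul_x, env_zero_right]

lemma yr_mul_yr : yr k * yr k = 0 := by
  simp [yr, env_mul, y_mul_y, env_zero_right]

lemma xl_mul_yl : xl k * yl k = -(yl k * xl k) := by
  simp [xl, yl, env_mul, x_mul_y, env_neg_left]

lemma yr_mul_xr : yr k * xr k = -(xr k * yr k) := by
  simp [xr, yr, env_mul, x_mul_y, env_neg_right]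

lemma xr_mul_xl : xr k * xl k = xl k * xr k := by simp [xr, xl, env_mul]

lemma yr_mul_yl : yr k * yl k = yl k * yr k := by simp [yr, yl, env_mul]

lemma xr_mul_yl : xr k * yl k = yl k * xr k := by simp [xr, yl, env_mul]

lemma yr_mul_xl : yr k * xl k = xl k * yr k := by simp [yr, xl, env_mul]

lemma y_y (s : AEnv k) (hs : s = 1 ∨ s = -1) :
    (yr k + -s * yl k) * (yr k + s * yl k) = 0 := by
  rcases hs with rfl | rfl <;>
    simp [add_mul, mul_add, yr_mul_yr, yl_mul_yl, yr_mul_yl]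

lemma x_x (s : AEnv k) (hs : s = 1 ∨ s = -1) :
    (xl k + -s * xr k) * (xl k + s * xr k) = 0 := by
  rcases hs with rfl | rfl <;>
    simp [add_mul, mul_add, xr_mul_xr, xl_mul_xl, xr_mul_xl]

lemma x_y (s : AEnv k) (hs : s = 1 ∨ s = -1) :
    (xl k + -s * xr k) * (yr k + s * yl k) = (yr k + -s * yl k) * (xl k + s * xr k) := by
  rcases hs with rfl | rfl <;>
    simp [add_mul, mul_add, xl_mul_yl, yr_mul_xr, xr_mul_yl, yr_mul_xl] <;> abel

lemma diff_diff (n : ℕ) (p : P k (n + 2)) : diff k n (diff k (n + 1) p) = 0 := by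
  funext l
  have hs := neg_one_pow_eq_or (AEnv k) (n + 1)
  simp only [diff_apply, Pi.zero_apply, Fin.val_succ, Fin.val_castSucc, pow_succ _ (n + 1),
    pow_succ _ (l : ℕ), mul_neg_one]
  generalize ((-1) ^ (n + 1) : AEnv k) = s at *
  have h1 := y_y k s hs
  have h2 := x_x k s hs
  have h3 := x_y k s hs
  generalize yr k + -s * yl k = a at *
  generalize yr k + s * yl k = b at *
  generalize xl k + -s * xr k = c at *
  generalize xl k + s * xr k = d at *
  have e1 : p l.castSucc.castSucc * a * b = 0 := by rw [mul_assoc, h1, mul_zero]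
  have e2 : p l.succ.succ * c * d = 0 := by rw [mul_assoc, h2, mul_zero]
  have e3 : p l.succ.castSucc * c * b = p l.succ.castSucc * a * d := by
    rw [mul_assoc, h3, mul_assoc]
  have e4 : l.castSucc.succ = l.succ.castSucc := rfl
  rw [e4]
  simp only [mul_sub, sub_mul, neg_mul, mul_assoc] at *
  rw [e1, e2, e3]
  simp

lemma aug_apply (p : P k 0) : aug k p = p 0 • (1 : Alg k) := by
  simp [aug, Fintype.linearCombination_apply]

lemma aug_diff (p : P k 1) : aug k (diff k 0 p) = 0 := by
  rw [aug_apply, diff_apply]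
  simp [sub_smul, mul_smul, add_smul, xl, xr, yl, yr, env_smul]

/-- The action of a skew derivation of `A` on the left factor of the enveloping algebra. -/
def envDer (u v : k) : AEnv k →ₗ[k] AEnv k := envMap k (skewDer k u v)

lemma envDer_mul_xl (u v : k) (p : AEnv k) :
    envDer k u v (p * xl k) = u • p - envDer k u v p * xl k := by
  induction p using env_induction with
  | tmul b c =>
    simp [envDer, xl, env_mul, envMap_env, skewDer_mul_x, sub_eq_add_neg, env_add_left,
      env_neg_left, env_smul_left]
  | add a b ha hb => simp only [add_mul, map_add, ha, hb, smul_add]; abel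

lemma envDer_mul_yl (u v : k) (p : AEnv k) :
    envDer k u v (p * yl k) = v • p - envDer k u v p * yl k := by
  induction p using env_induction with
  | tmul b c =>
    simp [envDer, yl, env_mul, envMap_env, skewDer_mul_y, sub_eq_add_neg, env_add_left,
      env_neg_left, env_smul_left]
  | add a b ha hb => simp only [add_mul, map_add, ha, hb, smul_add]; abel

lemma envDer_mul_xr (u v : k) (p : AEnv k) :
    envDer k u v (p * xr k) = envDer k u v p * xr k := by
  induction p using env_induction with
  | tmul b c => simp [envDer, xr, env_mul, envMap_env]
  | add a b ha hb => simp only [add_mul, map_add, ha, hb]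

lemma envDer_mul_yr (u v : k) (p : AEnv k) :
    envDer k u v (p * yr k) = envDer k u v p * yr k := by
  induction p using env_induction with
  | tmul b c => simp [envDer, yr, env_mul, envMap_env]
  | add a b ha hb => simp only [add_mul, map_add, ha, hb]

lemma envDer_sq (u v : k) (p : AEnv k) : envDer k u v (envDer k u v p) = 0 := by
  induction p using env_induction with
  | tmul b c => simp [envDer, envMap_env, skewDer_sq, env_zero_left]
  | add a b ha hb => simp only [map_add, ha, hb, add_zero]

lemma envDer_anticomm (u v u' v' : k) (p : AEnv k) :
    envDer k u v (envDer k u' v' p) = -envDer k u' v' (envDer k u v p) := by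
  rw [eq_neg_iff_add_eq_zero]
  induction p using env_induction with
  | tmul b c => simp [envDer, envMap_env, ← env_add_left, skewDer_anticomm, env_zero_left]
  | add a b ha hb =>
    simp only [map_add]
    rw [add_add_add_comm, ha, hb, add_zero]

lemma env_decomp (p : AEnv k) : ∃ b : Alg k,
    p = env k 1 b + envDer k 1 0 p * xl k +
      envDer k 0 1 (p - envDer k 1 0 p * xl k) * yl k := by
  induction p using env_induction with
  | tmul a c =>
    obtain ⟨r, hr⟩ := skewDer_decomp k a
    refine ⟨r • c, ?_⟩
    have h := congrArg (fun z => env k z c) hr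
    simp only [env_add_left, env_smul_left] at h
    rw [env_smul_right]
    refine h.trans ?_
    simp [envDer, envMap_env, xl, yl, env_mul, sub_eq_add_neg, ← env_neg_left, ← env_add_left]
  | add u v hu hv =>
    obtain ⟨b, hb⟩ := hu
    obtain ⟨c, hc⟩ := hv
    refine ⟨b + c, ?_⟩
    nth_rewrite 1 [hb, hc]
    simp only [map_add, map_sub, add_mul, sub_mul, env_add_right]
    abel

lemma sign_mul_self (n : ℕ) : ((-1) ^ n * (-1) ^ n : AEnv k) = 1 := by
  rw [← pow_add, ← two_mul, pow_mul]
  simp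

/-- Modulo boundaries every element of `P_n` is killed by the first skew derivation. -/
lemma exists_sub_diff_x (n : ℕ) (z : P k n) : ∃ q : P k (n + 1),
    ∀ l, envDer k 1 0 ((z - diff k n q) l) = 0 := by
  refine ⟨Fin.cons 0 fun l => (-1) ^ ((l : ℕ) + 1) * envDer k 1 0 (z l), fun l => ?_⟩
  have key : ∀ (m : ℕ) (p : AEnv k), envDer k 1 0 ((-1) ^ m * p) = (-1) ^ m * envDer k 1 0 p := by
    intro m p
    rcases neg_one_pow_eq_or (AEnv k) m with h | h <;> simp [h]
  have h0 : ∀ i : Fin (n + 2), envDer k 1 0 ((Fin.cons 0 fun l : Fin (n + 1) =>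
      (-1) ^ ((l : ℕ) + 1) * envDer k 1 0 (z l) : P k (n + 1)) i) = 0 := by
    intro i
    refine Fin.cases ?_ (fun j => ?_) i
    · simp
    · simp only [Fin.cons_succ, key, envDer_sq, mul_zero]
  rw [Pi.sub_apply, diff_apply]
  have h1 : envDer k 1 0 ((Fin.cons 0 fun l : Fin (n + 1) =>
      (-1) ^ ((l : ℕ) + 1) * envDer k 1 0 (z l) : P k (n + 1)) l.castSucc *
        (yr k + (-1) ^ (n + 1) * yl k)) = 0 := by
    rcases neg_one_pow_eq_or (AEnv k) (n + 1) with h | h <;>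
      simp [h, mul_add, envDer_mul_yr, envDer_mul_yl, h0]
  have h2 : envDer k 1 0 ((Fin.cons 0 fun l : Fin (n + 1) =>
      (-1) ^ ((l : ℕ) + 1) * envDer k 1 0 (z l) : P k (n + 1)) l.succ *
        (xl k + (-1) ^ (n + 1) * xr k)) = (-1) ^ ((l : ℕ) + 1) * envDer k 1 0 (z l) := by
    rcases neg_one_pow_eq_or (AEnv k) (n + 1) with h | h <;>
      simp [h, mul_add, envDer_mul_xr, envDer_mul_xl, key, envDer_sq, mul_assoc]
  rw [map_sub, key, map_sub, h1, h2, zero_sub, pow_succ, mul_neg_one, neg_mul, neg_neg,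
    ← mul_assoc, sign_mul_self, one_mul, sub_self]

lemma exists_sub_diff_xy (n : ℕ) (z : P k n) : ∃ q : P k (n + 1),
    (∀ l, envDer k 1 0 ((z - diff k n q) l) = 0) ∧ envDer k 0 1 ((z - diff k n q) 0) = 0 := by
  obtain ⟨q, hq⟩ := exists_sub_diff_x k n z
  set w := z - diff k n q with hw
  obtain ⟨c, hc⟩ : ∃ c : AEnv k, c = (-1) ^ (n + 1) * envDer k 0 1 (w 0) := ⟨_, rfl⟩
  refine ⟨q + Fin.cons c 0, ?_⟩
  have e : z - diff k n (q + Fin.cons c 0) = w - diff k n (Fin.cons c 0) := by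
    rw [map_add, hw]; abel
  have key : ∀ (u v : k) (p : AEnv k),
      envDer k u v ((-1) ^ (n + 1) * p) = (-1) ^ (n + 1) * envDer k u v p := by
    intro u v p
    rcases neg_one_pow_eq_or (AEnv k) (n + 1) with h | h <;> simp [h]
  have key' : ∀ p q : AEnv k, p * ((-1) ^ (n + 1) * q) = (-1) ^ (n + 1) * (p * q) := by
    intro p q
    rcases neg_one_pow_eq_or (AEnv k) (n + 1) with h | h <;> simp [h]
  have cy : envDer k 0 1 c = 0 := by
    rw [hc, key, envDer_sq, mul_zero]
  have cx : envDer k 1 0 c = 0 := by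
    rw [hc, key, envDer_anticomm, hq, map_zero, neg_zero, mul_zero]
  have d0 : diff k n (Fin.cons c 0) 0 = c * yr k + (-1) ^ (n + 1) * (c * yl k) := by
    rw [diff_apply]
    simp [mul_add, key']
  have dsucc : ∀ l : Fin (n + 1), l ≠ 0 → diff k n (Fin.cons c 0) l = 0 := by
    intro l hl
    obtain ⟨j, hj⟩ := Fin.exists_succ_eq.2 (Fin.castSucc_ne_zero_iff.2 hl)
    rw [diff_apply, ← hj]
    simp
  rw [e]
  constructor
  · intro l
    rw [Pi.sub_apply, map_sub, hq]
    by_cases hl : l = 0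
    · subst hl
      rw [d0, map_add, key, envDer_mul_yr, envDer_mul_yl, cx]
      simp
    · rw [dsucc l hl]
      simp
  · rw [Pi.sub_apply, map_sub, d0, map_add, key, envDer_mul_yr, envDer_mul_yl, cy, hc, one_smul,
      zero_mul, zero_mul, sub_zero, zero_add, ← mul_assoc, sign_mul_self, one_mul, sub_self]

lemma diff_exact (n : ℕ) (z : P k (n + 1)) (hz : diff k n z = 0) :
    ∃ q, diff k (n + 1) q = z := by
  obtain ⟨q, hx, hy⟩ := exists_sub_diff_xy k (n + 1) z
  set r := z - diff k (n + 1) q with hr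
  have hd : diff k n r = 0 := by rw [hr, map_sub, hz, diff_diff, sub_zero]
  have key' : ∀ p q : AEnv k, p * ((-1) ^ (n + 1) * q) = (-1) ^ (n + 1) * (p * q) := by
    intro p q
    rcases neg_one_pow_eq_or (AEnv k) (n + 1) with h | h <;> simp [h]
  have key : ∀ (u v : k) (p : AEnv k),
      envDer k u v ((-1) ^ (n + 1) * p) = (-1) ^ (n + 1) * envDer k u v p := by
    intro u v p
    rcases neg_one_pow_eq_or (AEnv k) (n + 1) with h | h <;> simp [h]
  have hl : ∀ l : Fin (n + 1), r l.castSucc * (yr k + (-1) ^ (n + 1) * yl k) -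
      r l.succ * (xl k + (-1) ^ (n + 1) * xr k) = 0 := by
    intro l
    have h := congrFun hd l
    rw [diff_apply] at h
    have h' := congrArg ((-1) ^ (l : ℕ) * ·) h
    simpa only [← mul_assoc, sign_mul_self, one_mul, Pi.zero_apply, mul_zero] using h'
  have hsucc : ∀ l : Fin (n + 1), r l.succ = 0 := by
    intro l
    have h := congrArg (envDer k 1 0) (hl l)
    simp only [mul_add, map_sub, map_add, key', key, envDer_mul_xl, envDer_mul_xr, envDer_mul_yl,
      envDer_mul_yr, hx] at h
    simpa using h
  have hzero : r 0 = 0 := by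
    have h := congrArg (envDer k 0 1) (hl 0)
    rw [hsucc 0, zero_mul, sub_zero, mul_add, map_add, key', key, envDer_mul_yl, envDer_mul_yr,
      map_zero, Fin.castSucc_zero, hy, one_smul, zero_mul, zero_mul, sub_zero, zero_add] at h
    have h' := congrArg ((-1) ^ (n + 1) * ·) h
    simpa only [← mul_assoc, sign_mul_self, one_mul, mul_zero] using h'
  have : r = 0 := by
    funext l
    refine Fin.cases hzero (fun j => hsucc j) l
  exact ⟨q, (sub_eq_zero.1 (hr.symm.trans this)).symm⟩

lemma aug_exact (z : P k 0) (hz : aug k z = 0) : ∃ q, diff k 0 q = z := by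
  obtain ⟨q, hx, hy⟩ := exists_sub_diff_xy k 0 z
  set r := z - diff k 0 q with hr
  have hd : aug k r = 0 := by rw [hr, map_sub, hz, aug_diff, sub_zero]
  obtain ⟨b, hb⟩ := env_decomp k (r 0)
  rw [hx, zero_mul, add_zero, sub_zero, hy, zero_mul, add_zero] at hb
  rw [aug_apply, hb, env_smul, one_mul, one_mul] at hd
  have : r = 0 := by
    funext l
    rw [Fin.fin_one_eq_zero l, hb, hd, env_zero_right]
    rfl
  exact ⟨q, (sub_eq_zero.1 (hr.symm.trans this)).symm⟩

lemma aug_surjective : Function.Surjective (aug k) := fun b =>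
  ⟨fun _ => env k b 1, by rw [aug_apply, env_smul, mul_one, mul_one]⟩

/-- The complex `⋯ → P_2 → P_1 → P_0`. -/
def cpx : ChainComplex (ModuleCat.{u} (AEnv k)) ℕ :=
  ChainComplex.of (fun n => ModuleCat.of (AEnv k) (P k n)) (fun n => ModuleCat.ofHom (diff k n))
    fun n => by
      ext1
      exact LinearMap.ext fun p => diff_diff k n p

lemma cpx_d (n : ℕ) : (cpx k).d (n + 1) n = ModuleCat.ofHom (diff k n) :=
  ChainComplex.of_d (fun n => ModuleCat.of (AEnv k) (P k n))
    (fun n => ModuleCat.ofHom (diff k n)) n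

/-- The augmentation as a map of complexes to `A` in degree `0`. -/
def cpxAug : cpx k ⟶ (ChainComplex.single₀ (ModuleCat.{u} (AEnv k))).obj (bimod k (Alg k)) :=
  ((cpx k).toSingle₀Equiv (bimod k (Alg k))).symm ⟨ModuleCat.ofHom (aug k), by
    rw [cpx_d]
    ext1
    exact LinearMap.ext fun p => aug_diff k p⟩

instance cpxAug_quasiIso : QuasiIso (cpxAug k) where
  quasiIsoAt m := by
    cases m with
    | zero =>
      rw [ChainComplex.quasiIsoAt₀_iff, ShortComplex.quasiIso_iff_of_zeros' _ rfl rfl rfl]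
      constructor
      · rw [ShortComplex.moduleCat_exact_iff]
        intro z hz
        obtain ⟨q, hq⟩ := aug_exact k z hz
        refine ⟨q, ?_⟩
        rw [← hq]
        exact congrArg (fun f => f.hom q) (cpx_d k 0)
      · rw [ModuleCat.epi_iff_surjective]
        exact aug_surjective k
    | succ m =>
      rw [quasiIsoAt_iff_exactAt' (hL := ChainComplex.exactAt_succ_single_obj ..),
        HomologicalComplex.exactAt_iff' _ (m + 2) (m + 1) m (by simp) (by simp),
        ShortComplex.moduleCat_exact_iff]
      intro z hz
      have hz' : diff k m z = 0 := by
        exact (congrArg (fun f => f.hom z) (cpx_d k m)).symm.trans hz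
      obtain ⟨q, hq⟩ := diff_exact k m z hz'
      refine ⟨q, ?_⟩
      rw [← hq]
      exact congrArg (fun f => f.hom q) (cpx_d k (m + 1))

/-- The complex `⋯ → P_1 → P_0 → A` is a projective bimodule resolution of `A`. -/
def resolution : ProjectiveResolution (bimod k (Alg k)) where
  complex := cpx k
  projective n := by
    have : Projective (ModuleCat.of (AEnv k) (P k n)) :=
      (IsProjective.iff_projective _).1 inferInstance
    exact this
  π := cpxAug k

end Resolution

section Classes

/-- The map `ξ_r : P_n → A`, `f_i^n ↦ δ_{ir}`. -/
def xiMap (n r : ℕ) : P k n →ₗ[AEnv k] Alg k :=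
  Fintype.linearCombination (AEnv k) fun i : Fin (n + 1) => if (i : ℕ) = r then (1 : Alg k) else 0

lemma xiMap_diff (t r : ℕ) (p : P k (2 * t + 1)) : xiMap k (2 * t) r (diff k (2 * t) p) = 0 := by
  rw [xiMap, Fintype.linearCombination_apply]
  refine Finset.sum_eq_zero fun i _ => ?_
  rw [diff_apply, (odd_two_mul_add_one t).neg_one_pow]
  split_ifs
  · simp [sub_smul, mul_smul, add_smul, xl, xr, yl, yr, env_smul, neg_smul]
  · rw [smul_zero]

/-- The class of `ξ_r : P_{2t} → A` in `Ext^{2t}(A, A)`. -/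
def xiExt (t r : ℕ) : Ext (bimod k (Alg k)) (bimod k (Alg k)) (2 * t) :=
  (resolution k).extMk (ModuleCat.ofHom (xiMap k (2 * t) r)) (2 * t + 1) rfl (by
    refine (congrArg (· ≫ ModuleCat.ofHom (xiMap k (2 * t) r)) (cpx_d k (2 * t))).trans ?_
    ext1
    exact LinearMap.ext fun p => xiMap_diff k t r p)

/-- The class `ξ_r^{2t}` in `HH^{2t}(A) ⊆ HH^*(A)`. -/
def xi (t r : ℕ) : HH k (Alg k) :=
  DirectSum.of (fun n : ℕ => Ext (bimod k (Alg k)) (bimod k (Alg k)) n) (2 * t) (xiExt k t r)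

/-- The subalgebra `R` generated by all classes `ξ_i^{2t}`, `0 ≤ i ≤ 2t`. -/
def R : Subalgebra k (HH k (Alg k)) :=
  Algebra.adjoin k {z | ∃ t i : ℕ, i ≤ 2 * t ∧ z = xi k t i}

/-- The class `ξ_i^{2t}` as an element of `R`. -/
def xiR (t i : ℕ) (h : i ≤ 2 * t) : R k :=
  ⟨xi k t i, Algebra.subset_adjoin ⟨t, i, h, rfl⟩⟩

/-- The `k`-subspace `R_j` of `R` spanned by the classes `ξ_i^{2t}` with `i ≡ j` modulo `2`. -/
def RPart (j : ZMod 2) : Submodule k (R k) :=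
  Submodule.span k {z | ∃ (t i : ℕ) (h : i ≤ 2 * t), (i : ZMod 2) = j ∧ z = xiR k t i h}

/-- The `k`-subalgebra of `R` generated by the classes `ξ_i^{2t}` with `i` even. -/
def RZero : Subalgebra k (R k) :=
  Algebra.adjoin k {z | ∃ (t i : ℕ) (h : i ≤ 2 * t), Even i ∧ z = xiR k t i h}

end Classes

end HochschildCohomology

end

open HochschildCohomology

/-! The whole structure of `R` follows from two facts: the multiplication table ξ_r^{2s} · ξ_q^{2t}
= ξ_{r+q}^{2(s+t)}, and the linear independence of all ξ_i^{2t} over `k`. Granting them, `R` is the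
algebra of the monoid of pairs (t, i) with 0 ≤ i ≤ 2t. Writing ξ_i^{2t} as u^{2t-i} v^i identifies
it with the even-degree part of k[u, v]. The parity of i gives the grading, R_0 is k[u², v²], and
R_1 is R_0 · uv with (uv)² = u²v².

The table (`xi_mul_xi`) rests on the periodicity of the resolution. Its differential depends on the
degree only through parity and is uniform in the index up to signs, so ξ_r^{2s} lifts to a chain map
that shifts indices by r (`diff_shiftMap`). The Yoneda product is then computed by composing with
this lift (`extMk_comp_extMk`), an identity checked in the derived category.

Independence (`linearIndependent_xi`) rests on minimality of the resolution. The coefficients of the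
differential act on `A` with values in the ideal (x, y), so every coboundary takes its values on
generators in that ideal (`counit_map_diff`), and a nonzero scalar cocycle of positive degree is
never a coboundary. -/

noncomputable section

/-! ### Products of cocycles as compositions of shifted morphisms -/

namespace CochainComplex.HomComplex.Cocycle

variable {C : Type*} [Category* C] [Preadditive C] {K L M : CochainComplex C ℤ}

/-- The composition of cocycles. -/
def comp {m n l : ℤ} (z : Cocycle K L m) (z' : Cocycle L M n) (h : m + n = l) : Cocycle K M l :=
  Cocycle.mk (z.1.comp z'.1 h) _ rfl (by
    rw [δ_comp z.1 z'.1 h (m + 1) (n + 1) (l + 1) rfl rfl rfl, z.δ_eq_zero, z'.δ_eq_zero]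
    simp)

lemma equivHomShift_symm_comp {m n l : ℤ} (z : Cocycle K L m) (z' : Cocycle L M n)
    (h : m + n = l) :
    equivHomShift.symm (z.comp z' h) =
      ShiftedHom.comp (equivHomShift.symm z) (equivHomShift.symm z')
        ((add_comm n m).trans h) := by
  subst h
  ext p
  simp only [equivHomShift_symm_apply, comp, homOf_f, rightShift_coe, mk_coe,
    ShiftedHom.comp, HomologicalComplex.comp_f, CochainComplex.shiftFunctor_map_f',
    CochainComplex.shiftFunctorAdd'_inv_app_f']
  rw [Cochain.rightShift_v _ _ _ _ p p (add_zero p) (p + m + n) (by lia),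
    Cochain.rightShift_v _ _ _ _ p p (add_zero p) (p + m) rfl,
    Cochain.rightShift_v _ _ _ _ (p + m) (p + m) (add_zero _) (p + m + n) rfl,
    Cochain.comp_v _ _ rfl p (p + m) (p + m + n) rfl rfl]
  simp [shiftFunctorObjXIso, HomologicalComplex.XIsoOfEq]
  erw [Category.comp_id, Category.comp_id]
  exact Category.assoc _ _ _

end CochainComplex.HomComplex.Cocycle

/-! ### Yoneda products computed by lifts between resolutions -/

namespace CategoryTheory.ProjectiveResolution

open CochainComplex HomComplex

variable {C : Type*} [Category* C] [Abelian C] {X Y : C}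

/-- The cochain of degree `m` given by maps `R_{m+j} → R'_j`. -/
def liftCochain (R : ProjectiveResolution X) (R' : ProjectiveResolution Y) (m : ℕ)
    (φ : ∀ i j, R.complex.X i ⟶ R'.complex.X j) :
    Cochain R.cochainComplex R'.cochainComplex m :=
  Cochain.mk fun p q hpq =>
    -- Resolutions live in nonpositive cohomological degrees. Since m ≥ 0, q ≤ 0 forces p ≤ 0, so
    -- both truncations to naturals are exact; for q > 0 the target is zero.
    if hq : q ≤ 0 then
      (R.cochainComplexXIso p (-p).toNat (by lia)).hom ≫ φ _ _ ≫
        (R'.cochainComplexXIso q (-q).toNat (by lia)).inv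
    else 0

lemma liftCochain_v (R : ProjectiveResolution X) (R' : ProjectiveResolution Y) (m : ℕ)
    (φ : ∀ i j, R.complex.X i ⟶ R'.complex.X j) (p q : ℤ) (hpq : p + m = q) (i j : ℕ)
    (hi : -i = p) (hj : -j = q) :
    (liftCochain R R' m φ).v p q hpq =
      (R.cochainComplexXIso p i hi).hom ≫ φ i j ≫ (R'.cochainComplexXIso q j hj).inv := by
  obtain rfl : i = (-p).toNat := by lia
  obtain rfl : j = (-q).toNat := by lia
  exact dif_pos (by lia)

/-- The cocycle of degree `m` given by maps `R_{m+j} → R'_j` that commute with the differentials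
up to the sign `(-1)^m`. -/
def liftCocycle (R : ProjectiveResolution X) (R' : ProjectiveResolution Y) (m : ℕ)
    (φ : ∀ i j, R.complex.X i ⟶ R'.complex.X j)
    (hφ : ∀ j, φ (m + j + 1) (j + 1) ≫ R'.complex.d (j + 1) j =
      (m : ℤ).negOnePow • R.complex.d (m + j + 1) (m + j) ≫ φ (m + j) j) :
    Cocycle R.cochainComplex R'.cochainComplex m :=
  Cocycle.mk (liftCochain R R' m φ) _ rfl (by
    ext p q hpq
    by_cases hq : q ≤ 0
    · obtain ⟨j, rfl⟩ := Int.exists_eq_neg_ofNat hq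
      rw [δ_v _ _ rfl _ p _ (by lia) (p + m) (p + 1) (by lia) (by lia),
        liftCochain_v _ _ _ _ _ _ _ (m + j + 1) (j + 1) (by lia) (by lia),
        liftCochain_v _ _ _ _ _ _ _ (m + j) j (by lia) (by lia),
        R'.cochainComplex_d _ _ (j + 1) j (by lia) (by lia),
        R.cochainComplex_d _ _ (m + j + 1) (m + j) (by lia) (by lia)]
      simp [reassoc_of% hφ, Int.negOnePow_succ]
    · exact (isZero_of_isStrictlyLE _ 0 _ (by lia)).eq_of_tgt _ _)

variable [HasExt C] {Z : C}

/-- In the derived category the class of `z` is the inverse of the quasi-isomorphism `R'.π'`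
followed by `z`. The factor `R'.π'` appended to `Φ` cancels this inverse. -/
lemma extEquivCohomologyClass_symm_comp (R : ProjectiveResolution X) (R' : ProjectiveResolution Y)
    {m n l : ℕ} (h : m + n = l) (Φ : Cocycle R.cochainComplex R'.cochainComplex m)
    (z : Cocycle R'.cochainComplex ((CochainComplex.singleFunctor C 0).obj Z) n) :
    (R.extEquivCohomologyClass.symm (.mk (Φ.postcomp R'.π'))).comp
        (R'.extEquivCohomologyClass.symm (.mk z)) h =
      R.extEquivCohomologyClass.symm (.mk (Φ.comp z (by lia))) := by
  have := HasDerivedCategory.standard C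
  ext
  rw [Ext.comp_hom, extEquivCohomologyClass_symm_mk_hom, extEquivCohomologyClass_symm_mk_hom,
    extEquivCohomologyClass_symm_mk_hom, Cocycle.equivHomShift_symm_postcomp,
    Cocycle.equivHomShift_symm_comp, ShiftedHom.map_comp, ← ShiftedHom.comp_mk₀ _ 0 rfl,
    ShiftedHom.map_comp, ShiftedHom.map_mk₀]
  simp only [ShiftedHom.mk₀_comp, ShiftedHom.comp_mk₀]
  simp only [ShiftedHom.comp, Functor.map_comp, Category.assoc]
  simp only [← Functor.map_comp_assoc, Iso.inv_hom_id_app_assoc, IsIso.hom_inv_id_assoc]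
  simp only [Functor.map_comp, Category.assoc]
  erw [← NatTrans.naturality]
  rfl

/-- The Yoneda product of classes of cocycles, computed by a lift of the first cocycle. -/
lemma extMk_comp_extMk (R : ProjectiveResolution X) (R' : ProjectiveResolution Y) {m n l : ℕ}
    (h : m + n = l) (φ : ∀ i j, R.complex.X i ⟶ R'.complex.X j)
    (hφ : ∀ j, φ (m + j + 1) (j + 1) ≫ R'.complex.d (j + 1) j =
      (m : ℤ).negOnePow • R.complex.d (m + j + 1) (m + j) ≫ φ (m + j) j)
    (f : R.complex.X m ⟶ Y) (hf : R.complex.d (m + 1) m ≫ f = 0)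
    (hφf : φ m 0 ≫ R'.π.f 0 ≫ (HomologicalComplex.singleObjXSelf (.down ℕ) 0 Y).hom = f)
    (g : R'.complex.X n ⟶ Z) (hg : R'.complex.d (n + 1) n ≫ g = 0)
    (hφg : R.complex.d (l + 1) l ≫ φ l n ≫ g = 0) :
    (R.extMk f (m + 1) rfl hf).comp (R'.extMk g (n + 1) rfl hg) h =
      R.extMk (φ l n ≫ g) (l + 1) rfl hφg := by
  rw [extMk, extMk, extMk]
  convert extEquivCohomologyClass_symm_comp R R' h (liftCocycle R R' m φ hφ) _ using 4
  -- A cochain into a complex concentrated in degree 0 is determined by one component, so both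
  -- cocycle identities reduce to an equality of single maps.
  · ext : 1
    refine (Cochain.toSingleEquiv (show -(m : ℤ) + m = 0 by lia)).injective ?_
    subst hφf
    simp [Cochain.toSingleEquiv, liftCocycle, π'_f_zero,
      liftCochain_v R R' m φ (-m) 0 (by lia) m 0 (by lia) (by lia)]
    refine congrArg (· ≫ _) ?_
    erw [Category.comp_id, Category.assoc, Category.assoc, Iso.inv_hom_id_assoc]
    rfl
  · ext : 1
    refine (Cochain.toSingleEquiv (show -(l : ℤ) + l = 0 by lia)).injective ?_
    simp [Cochain.toSingleEquiv, liftCocycle, Cocycle.comp,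
      Cochain.comp_v _ _ (show (m : ℤ) + n = l by lia) (-l) (-n) 0 (by lia) (by lia),
      liftCochain_v R R' m φ (-l) (-n) (by lia) l n (by lia) (by lia)]
    refine congrArg (· ≫ _) ?_
    erw [Category.assoc, Category.assoc, Iso.inv_hom_id_assoc]
    rfl

end CategoryTheory.ProjectiveResolution

/-! ### The multiplication table of the classes ξ_i^{2t} -/

namespace HochschildCohomology

variable (k : Type u) [Field k]

/-- The map `P_i → P_j`, `f_l^i ↦ (-1)^{ri} f_{l-r}^j`. -/
def shiftMap (r i j : ℕ) : P k i →ₗ[AEnv k] P k j where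
  toFun p l := if h : l + r < i + 1 then p ⟨l + r, h⟩ * (-1) ^ (r * i) else 0
  map_add' p q := by
    ext l
    simp only [Pi.add_apply]
    split_ifs <;> simp [add_mul]
  map_smul' a p := by
    ext l
    simp only [Pi.smul_apply, smul_eq_mul, RingHom.id_apply]
    split_ifs <;> simp [mul_assoc]

variable {k}

lemma shiftMap_apply {r i j : ℕ} (p : P k i) (l : Fin (j + 1)) (h : l + r < i + 1) :
    shiftMap k r i j p l = (-1) ^ (r * i) * p ⟨l + r, h⟩ :=
  (dif_pos h).trans (neg_one_pow_mul_comm k _ _)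

/-- As m is even, the differentials out of degrees m+j+1 and j+1 have the same type (α or β).
Shifting the index by r changes the sign (-1)^l by (-1)^r, and this is the ratio of the factors
(-1)^{ri} in consecutive degrees. The bound r ≤ m keeps every index l + r in range. -/
lemma diff_shiftMap {r m : ℕ} (hm : Even m) (hr : r ≤ m) (j : ℕ) (p : P k (m + j + 1)) :
    diff k j (shiftMap k r (m + j + 1) (j + 1) p) =
      shiftMap k r (m + j) j (diff k (m + j) p) := by
  ext l
  have hl := l.isLt
  rw [shiftMap_apply _ _ (by omega), diff_apply, diff_apply,
    shiftMap_apply _ _ (by simp; omega), shiftMap_apply _ _ (by simp; omega)]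
  have e₁ : (⟨l.castSucc + r, by simp; omega⟩ : Fin (m + j + 1 + 1)) =
      Fin.castSucc ⟨l + r, by omega⟩ := rfl
  have e₂ : (⟨l.succ + r, by simp; omega⟩ : Fin (m + j + 1 + 1)) =
      Fin.succ ⟨l + r, by omega⟩ := by
    ext
    simp
    omega
  rw [e₁, e₂, show (-1 : AEnv k) ^ (m + j + 1) = (-1) ^ (j + 1) by
    rw [add_assoc, pow_add, hm.neg_one_pow, one_mul], mul_add_one, pow_add _ _ r, show ((⟨l + r, by omega⟩ : Fin (m + j + 1)) : ℕ) = l + r from rfl,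
    pow_add _ (l : ℕ) r]
  rcases neg_one_pow_eq_or (AEnv k) (l : ℕ) with h₁ | h₁ <;>
  rcases neg_one_pow_eq_or (AEnv k) (r * (m + j)) with h₂ | h₂ <;>
  rcases neg_one_pow_eq_or (AEnv k) r with h₃ | h₃ <;> simp [h₁, h₂, h₃, neg_add_eq_sub]

lemma xiMap_apply {n r : ℕ} (hr : r ≤ n) (p : P k n) :
    xiMap k n r p = p ⟨r, Nat.lt_succ_of_le hr⟩ • (1 : Alg k) := by
  rw [xiMap, Fintype.linearCombination_apply, Finset.sum_eq_single ⟨r, Nat.lt_succ_of_le hr⟩]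
  · simp
  · intro i _ hi
    rw [if_neg fun h => hi (Fin.ext h), smul_zero]
  · simp

lemma aug_shiftMap {r m : ℕ} (hm : Even m) (hr : r ≤ m) (p : P k m) :
    aug k (shiftMap k r m 0 p) = xiMap k m r p := by
  rw [aug_apply, shiftMap_apply _ _ (by simpa using Nat.lt_succ_of_le hr),
    (hm.mul_left r).neg_one_pow, one_mul, xiMap_apply hr]
  simp

lemma xiMap_shiftMap {m n r q : ℕ} (hm : Even m) (hn : Even n) (hr : r ≤ m) (hq : q ≤ n)
    (p : P k (m + n)) :
    xiMap k n q (shiftMap k r (m + n) n p) = xiMap k (m + n) (r + q) p := by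
  rw [xiMap_apply hq, xiMap_apply (by omega), shiftMap_apply _ _ (by simp; omega),
    ((hm.add hn).mul_left r).neg_one_pow, one_mul]
  congr 3
  exact add_comm q r

lemma resolution_d (n : ℕ) :
    (resolution k).complex.d (n + 1) n = ModuleCat.ofHom (diff k n) :=
  cpx_d k n

/-- The degree `l` and the map `g'` are kept free, with a pointwise hypothesis, so that degrees
equal only propositionally, such as 2s + 2t and 2(s + t), can be used. -/
lemma extMk_comp_xi {m n r : ℕ} (hm : Even m) (hr : r ≤ m)
    (hf : (resolution k).complex.d (m + 1) m ≫ ModuleCat.ofHom (xiMap k m r) = 0)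
    (g : P k n →ₗ[AEnv k] Alg k)
    (hg : (resolution k).complex.d (n + 1) n ≫ ModuleCat.ofHom g = 0) {l : ℕ} (h : m + n = l)
    (g' : P k l →ₗ[AEnv k] Alg k)
    (hg' : (resolution k).complex.d (l + 1) l ≫ ModuleCat.ofHom g' = 0)
    (e : ∀ p, g (shiftMap k r l n p) = g' p) :
    ((resolution k).extMk (ModuleCat.ofHom (xiMap k m r)) (m + 1) rfl hf).comp
      ((resolution k).extMk (ModuleCat.ofHom g) (n + 1) rfl hg) h =
    (resolution k).extMk (ModuleCat.ofHom g') (l + 1) rfl hg' := by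
  have e' : ModuleCat.ofHom (shiftMap k r l n) ≫ ModuleCat.ofHom g = ModuleCat.ofHom g' := by
    ext1
    exact LinearMap.ext e
  subst h
  refine (ProjectiveResolution.extMk_comp_extMk (resolution k) (resolution k) rfl
    (fun i j => ModuleCat.ofHom (shiftMap k r i j)) (fun j => ?_) _ hf ?_ _ hg ?_).trans ?_
  · rw [resolution_d, resolution_d, (Int.even_coe_nat m |>.2 hm |> Int.negOnePow_even _), one_smul]
    ext1
    exact LinearMap.ext fun p => diff_shiftMap hm hr j p
  · refine Eq.trans ?_ (ModuleCat.hom_ext (LinearMap.ext (aug_shiftMap hm hr)) :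
      ModuleCat.ofHom (shiftMap k r m 0) ≫ ModuleCat.ofHom (aug k) = ModuleCat.ofHom (xiMap k m r))
    refine congrArg (ModuleCat.ofHom (shiftMap k r m 0) ≫ ·) ?_
    exact (Category.comp_id _).trans (ChainComplex.toSingle₀Equiv_symm_apply_f_zero _ _)
  · exact (congrArg (_ ≫ ·) e').trans hg'
  · congr 1

lemma xiExt_comp_xiExt {s t r q : ℕ} (hr : r ≤ 2 * s) (hq : q ≤ 2 * t) :
    (xiExt k s r).comp (xiExt k t q) (by ring : 2 * s + 2 * t = 2 * (s + t)) =
      xiExt k (s + t) (r + q) := by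
  refine extMk_comp_xi (even_two_mul s) hr _ _ _ _ _ _ fun p => ?_
  have h : 2 * (s + t) = 2 * s + 2 * t := by ring
  -- The type of `p` depends on the degree, so `p` goes back into the goal before the degree is
  -- rewritten.
  revert p
  rw [h]
  exact xiMap_shiftMap (even_two_mul s) (even_two_mul t) hr hq

lemma xi_mul_xi {s t r q : ℕ} (hr : r ≤ 2 * s) (hq : q ≤ 2 * t) :
    xi k s r * xi k t q = xi k (s + t) (r + q) := by
  rw [xi, xi, xi, DirectSum.of_mul_of]
  apply DirectSum.of_eq_of_gradedMonoid_eq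
  rw [← xiExt_comp_xiExt hr hq]
  exact ext_mk_mul_mk _ _ _

/-- The lift of ξ_0^0 is the identity on `P_0`, so ξ_0^0 is a left unit for every degree 0 class.
Applied to the identity class, represented by some unspecified cocycle `g`, this gives the equality.
-/
lemma xiExt_zero_zero : xiExt k 0 0 = Ext.mk₀ (𝟙 (bimod k (Alg k))) := by
  obtain ⟨g, hg, e⟩ := (resolution k).extMk_surjective (Ext.mk₀ (𝟙 (bimod k (Alg k)))) 1 rfl
  have h : (xiExt k 0 0).comp ((resolution k).extMk g 1 rfl hg) (zero_add 0) =
      (resolution k).extMk g 1 rfl hg :=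
    extMk_comp_xi Even.zero le_rfl _ g.hom hg _ g.hom hg fun p => congrArg g.hom (by
      refine funext fun l => ?_
      rw [Fin.fin_one_eq_zero l, shiftMap_apply _ _ (by simp)]
      simp)
  rw [e] at h
  exact (Ext.comp_mk₀_id _).symm.trans h

lemma xi_zero_zero : xi k 0 0 = 1 :=
  congrArg (DirectSum.of (fun n : ℕ => Ext (bimod k (Alg k)) (bimod k (Alg k)) n) 0)
    xiExt_zero_zero

end HochschildCohomology

/-! ### Linear independence of the classes ξ_i^{2t} -/

namespace HochschildCohomology

variable (k : Type u) [Field k]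

/-- The augmentation of `A` with `x, y ↦ 0`. -/
def counit : Alg k →ₐ[k] k :=
  QCI.lift (FreeAlgebra.lift k 0) (by
    intro a b h
    induction h <;> simp)

lemma counit_x : counit k (x k) = 0 := by
  simp [counit, x, QCI.lift_mk]

lemma counit_y : counit k (y k) = 0 := by
  simp [counit, y, QCI.lift_mk]

variable {k}

/-- Minimality of the resolution: α and β act on `A` through left and right multiplication by x or
y, which the counit kills. -/
lemma counit_map_diff {n : ℕ} (g : P k n →ₗ[AEnv k] Alg k) (i : Fin (n + 2)) :
    counit k (g (diff k n (Pi.single i 1))) = 0 := by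
  have h₁ : ∀ a : Alg k, counit k (betaX k • a) = 0 := fun a => by
    simp [betaX, xl, xr, add_smul, env_smul, counit_x]
  have h₂ : ∀ a : Alg k, counit k (betaY k • a) = 0 := fun a => by
    simp [betaY, yl, yr, add_smul, env_smul, counit_y]
  have h₃ : ∀ a : Alg k, counit k (alphaX k • a) = 0 := fun a => by
    simp [alphaX, xl, xr, sub_smul, env_smul, counit_x]
  have h₄ : ∀ a : Alg k, counit k (alphaY k • a) = 0 := fun a => by
    simp [alphaY, yl, yr, sub_smul, env_smul, counit_y]
  have hs : ∀ a : Alg k, counit k a = 0 → counit k ((-1 : AEnv k) ^ (i : ℕ) • a) = 0 := by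
    intro a ha
    rcases neg_one_pow_eq_or (AEnv k) (i : ℕ) with h | h <;> simp [h, ha]
  rw [diff, Fintype.linearCombination_apply_single, one_smul]
  split_ifs
  · rw [g.map_smul, map_add, g.map_smul, g.map_smul]
    refine hs _ ?_
    rw [map_add, h₂, h₁, add_zero]
  · rw [g.map_smul, map_sub, g.map_smul, g.map_smul]
    refine hs _ ?_
    rw [map_sub, h₄, h₃, sub_zero]

variable (k)

/-- The map `P_n → A`, `f_i ↦ c_i`. -/
def scalarMap (n : ℕ) (c : Fin (n + 1) → k) : P k n →ₗ[AEnv k] Alg k :=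
  Fintype.linearCombination (AEnv k) fun i => c i • (1 : Alg k)

lemma scalarMap_diff (t : ℕ) (c : Fin (2 * t + 1) → k) :
    (resolution k).complex.d (2 * t + 1) (2 * t) ≫ ModuleCat.ofHom (scalarMap k (2 * t) c) = 0 := by
  rw [resolution_d]
  ext1
  refine LinearMap.ext fun (p : P k (2 * t + 1)) => ?_
  change scalarMap k (2 * t) c (diff k (2 * t) p) = 0
  rw [scalarMap, Fintype.linearCombination_apply]
  refine Finset.sum_eq_zero fun i _ => ?_
  rw [diff_apply, (odd_two_mul_add_one t).neg_one_pow]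
  simp [sub_smul, mul_smul, add_smul, xl, xr, yl, yr, env_smul, neg_smul]

/-- Scalars act on bimodule maps through the enveloping algebra; this matches that action with the
one on `A`. -/
lemma algebraMap_env_smul (r : k) (a : Alg k) : algebraMap k (AEnv k) r • a = r • a := by
  have h : algebraMap k (AEnv k) r = env k (r • 1) 1 := by
    rw [env_smul_left, Algebra.algebraMap_eq_smul_one]
    rfl
  rw [h, env_smul, mul_one, smul_one_mul]

/-- The class of the cocycle `f_i ↦ c_i` as a linear function of `c`. -/
def scalarExt (t : ℕ) :
    (Fin (2 * t + 1) → k) →ₗ[k] Ext (bimod k (Alg k)) (bimod k (Alg k)) (2 * t) where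
  toFun c := (resolution k).extMk (ModuleCat.ofHom (scalarMap k (2 * t) c)) (2 * t + 1) rfl
    (scalarMap_diff k t c)
  map_add' c d := by
    refine Eq.trans ?_ (ProjectiveResolution.add_extMk _ _ _ _ _ _ _).symm
    congr 1
    ext1
    refine LinearMap.ext fun p => ?_
    change scalarMap k (2 * t) (c + d) p = scalarMap k (2 * t) c p + scalarMap k (2 * t) d p
    simp [scalarMap, Fintype.linearCombination_apply, add_smul, Finset.sum_add_distrib]
  map_smul' r c := by
    -- Scaling an Ext class is composing with the class of r • 𝟙, which acts on representing
    -- cocycles by postcomposition.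
    rw [RingHom.id_apply, ← Ext.comp_mk₀_id ((resolution k).extMk _ _ _ (scalarMap_diff k t c)),
      ← Ext.comp_smul, ← Ext.mk₀_smul]
    refine Eq.trans ?_ (ProjectiveResolution.extMk_comp_mk₀ _ _ _ _ _ _).symm
    congr 1
    ext1
    refine LinearMap.ext fun p => ?_
    change scalarMap k (2 * t) (r • c) p = algebraMap k (AEnv k) r • scalarMap k (2 * t) c p
    rw [scalarMap, scalarMap, Fintype.linearCombination_apply, Fintype.linearCombination_apply,
      Finset.smul_sum]
    refine Finset.sum_congr rfl fun i _ => ?_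
    rw [Pi.smul_apply, smul_eq_mul, mul_smul, ← algebraMap_env_smul k r, ← mul_smul, ← mul_smul,
      Algebra.commutes]

lemma scalarExt_single (t : ℕ) (i : Fin (2 * t + 1)) :
    scalarExt k t (Pi.single i 1) = xiExt k t i := by
  have h : scalarMap k (2 * t) (Pi.single i 1) = xiMap k (2 * t) i := by
    refine congrArg (Fintype.linearCombination (AEnv k)) (funext fun j => ?_)
    simp [Pi.single_apply, Fin.ext_iff, ite_smul]
  -- `extMk` carries a proof about its cocycle, so equal cocycles are exchanged together with their
  -- proofs.
  have congr : ∀ (f g : P k (2 * t) →ₗ[AEnv k] Alg k)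
      (hf : (resolution k).complex.d (2 * t + 1) (2 * t) ≫ ModuleCat.ofHom f = 0)
      (hg : (resolution k).complex.d (2 * t + 1) (2 * t) ≫ ModuleCat.ofHom g = 0), f = g →
      (resolution k).extMk (ModuleCat.ofHom f) (2 * t + 1) rfl hf =
        (resolution k).extMk (ModuleCat.ofHom g) (2 * t + 1) rfl hg := by
    rintro f _ _ _ rfl
    rfl
  exact congr _ _ (scalarMap_diff k t _) (h ▸ scalarMap_diff k t _) h

/-- If f_i ↦ c_i is a coboundary g ∘ d, evaluating at f_i and applying the counit gives c_i = 0.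
Positive degree is needed for `g` to have a source `P_{2t+1}`. -/
lemma scalarExt_injective (t : ℕ) : Function.Injective (scalarExt k (t + 1)) := by
  rw [← LinearMap.ker_eq_bot, LinearMap.ker_eq_bot']
  intro c hc
  obtain ⟨g, hg⟩ := ((resolution k).extMk_eq_zero_iff _ _ rfl
    (scalarMap_diff k (t + 1) c) (2 * t + 1) rfl).1 hc
  funext i
  have h := counit_map_diff g.hom i
  have e : g.hom (diff k (2 * t + 1) (Pi.single i 1)) = c i • 1 := by
    have hg' := (congrArg (· ≫ g) (resolution_d (2 * t + 1)).symm).trans hg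
    refine (congrArg (fun f => f.hom (Pi.single i 1)) hg').trans ?_
    change scalarMap k (2 * t + 2) c (Pi.single i 1) = _
    rw [scalarMap, Fintype.linearCombination_apply_single, one_smul]
  simpa using (congrArg (counit k) e).symm.trans h

lemma linearIndependent_xiExt_succ (t : ℕ) :
    LinearIndependent k fun i : Fin (2 * (t + 1) + 1) => xiExt k (t + 1) i := by
  have h := (Pi.basisFun k (Fin (2 * (t + 1) + 1))).linearIndependent.map'
    (scalarExt k (t + 1)) (LinearMap.ker_eq_bot.2 (scalarExt_injective k t))
  have e : (fun i : Fin (2 * (t + 1) + 1) => xiExt k (t + 1) i) =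
      scalarExt k (t + 1) ∘ Pi.basisFun k (Fin (2 * (t + 1) + 1)) := by
    funext i
    rw [Function.comp_apply, Pi.basisFun_apply, scalarExt_single]
  rw [e]
  exact h

/-- Otherwise ξ_0^2 = ξ_0^0 · ξ_0^2 would vanish, against independence in degree 2. -/
lemma xiExt_zero_zero_ne_zero : xiExt k 0 0 ≠ 0 := by
  intro h
  have h₁ := xi_mul_xi (k := k) (s := 0) (t := 1) (r := 0) (q := 0) le_rfl (by simp)
  rw [xi, h, map_zero, zero_mul] at h₁
  exact (linearIndependent_xiExt_succ k 0).ne_zero 0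
    (DirectSum.of_injective (β := fun n : ℕ => Ext (bimod k (Alg k)) (bimod k (Alg k)) n) _
      (h₁.symm.trans (map_zero _).symm))

lemma linearIndependent_xiExt (t : ℕ) :
    LinearIndependent k fun i : Fin (2 * t + 1) => xiExt k t i := by
  cases t with
  | zero =>
    have : Unique (Fin (2 * 0 + 1)) := inferInstanceAs (Unique (Fin 1))
    rw [linearIndependent_unique_iff, Fin.val_eq_zero_iff.2 (Subsingleton.elim _ _)]
    exact xiExt_zero_zero_ne_zero k
  | succ t => exact linearIndependent_xiExt_succ k t

/-- The projection of `HH^*(A)` to its even part. -/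
def evenComponents :
    HH k (Alg k) →ₗ[k] Π₀ t : ℕ, Ext (bimod k (Alg k)) (bimod k (Alg k)) (2 * t) where
  toFun := DFinsupp.comapDomain (fun t => 2 * t) (mul_right_injective₀ two_ne_zero)
  map_add' _ _ := DFinsupp.comapDomain_add _ _ _ _
  map_smul' _ _ := DFinsupp.comapDomain_smul _ _ _ _

/-- Classes in different degrees lie in different summands. Projecting to the even components
reindexes the degree 2t by t, so independence in each degree suffices. -/
lemma linearIndependent_xi :
    LinearIndependent k fun p : Σ t : ℕ, Fin (2 * t + 1) => xi k p.1 p.2 := by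
  have h := DFinsupp.linearIndependent_single (R := k)
    (fun t (i : Fin (2 * t + 1)) => xiExt k t i) (linearIndependent_xiExt k)
  refine LinearIndependent.of_comp (evenComponents k) ?_
  convert h with p
  exact DFinsupp.comapDomain_single (fun t => 2 * t)
    (mul_right_injective₀ two_ne_zero) _ _

end HochschildCohomology

/-! ### The structure of R as a monoid algebra -/

lemma Algebra.toSubmodule_adjoin_eq_span {K B : Type*} [CommSemiring K] [Semiring B] [Algebra K B]
    {s : Set B} (one : 1 ∈ s) (mul : ∀ a ∈ s, ∀ b ∈ s, a * b ∈ s) :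
    Subalgebra.toSubmodule (Algebra.adjoin K s) = Submodule.span K s := by
  let S : Submonoid B := ⟨⟨s, fun {a b} ha hb => mul a ha b hb⟩, one⟩
  have h : Submonoid.closure s ≤ S := Submonoid.closure_le.2 le_rfl
  exact Algebra.adjoin_eq_span_of_subset K fun a ha => Submodule.subset_span (h ha)

namespace HochschildCohomology

variable (k : Type u) [Field k]

lemma toSubmodule_R :
    Subalgebra.toSubmodule (R k) =
      Submodule.span k {z | ∃ t i : ℕ, i ≤ 2 * t ∧ z = xi k t i} := by
  refine Algebra.toSubmodule_adjoin_eq_span ⟨0, 0, le_rfl, xi_zero_zero.symm⟩ ?_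
  rintro _ ⟨s, i, hi, rfl⟩ _ ⟨t, j, hj, rfl⟩
  exact ⟨s + t, i + j, by omega, xi_mul_xi hi hj⟩

lemma R_le_HHEven : Subalgebra.toSubmodule (R k) ≤ HHEven k (Alg k) := by
  rw [toSubmodule_R, Submodule.span_le]
  rintro _ ⟨t, i, -, rfl⟩
  exact Submodule.mem_iSup_of_mem t ⟨xiExt k t i, rfl⟩

variable {k} in
lemma xiR_mul_xiR {s t i j : ℕ} (hi : i ≤ 2 * s) (hj : j ≤ 2 * t) :
    xiR k s i hi * xiR k t j hj = xiR k (s + t) (i + j) (by omega) :=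
  Subtype.ext (xi_mul_xi hi hj)

lemma xiR_zero_zero : xiR k 0 0 le_rfl = 1 := Subtype.ext xi_zero_zero

variable {k} in
lemma xiR_congr {s t i j : ℕ} (hi : i ≤ 2 * s) (hs : s = t) (hj : i = j) :
    xiR k s i hi = xiR k t j (hs ▸ hj ▸ hi) := by
  subst hs hj
  rfl

/-- The family of all `ξ_i^{2t}` in `R`. -/
def xiFam (p : Σ t : ℕ, Fin (2 * t + 1)) : R k := xiR k p.1 p.2 (Nat.le_of_lt_succ p.2.2)

lemma linearIndependent_xiFam : LinearIndependent k (xiFam k) :=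
  LinearIndependent.of_comp (R k).val.toLinearMap (linearIndependent_xi k)

lemma span_range_xiFam : Submodule.span k (Set.range (xiFam k)) = ⊤ := by
  refine Submodule.map_injective_of_injective (f := (R k).val.toLinearMap)
    Subtype.val_injective ?_
  rw [Submodule.map_span, Submodule.map_top, ← Set.range_comp]
  refine Eq.trans ?_ ((toSubmodule_R k).symm.trans (congrArg Subalgebra.toSubmodule (Subalgebra.range_val (R k))).symm)
  congr 1
  ext z
  constructor
  · rintro ⟨p, rfl⟩
    exact ⟨p.1, p.2, Nat.le_of_lt_succ p.2.2, rfl⟩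
  · rintro ⟨t, i, hi, rfl⟩
    exact ⟨⟨t, ⟨i, Nat.lt_succ_of_le hi⟩⟩, rfl⟩

lemma RPart_eq_span_image (j : ZMod 2) :
    RPart k j = Submodule.span k (xiFam k '' {p | ((p.2 : ℕ) : ZMod 2) = j}) := by
  rw [RPart]
  congr 1
  ext z
  constructor
  · rintro ⟨t, i, hi, hj, rfl⟩
    exact ⟨⟨t, ⟨i, Nat.lt_succ_of_le hi⟩⟩, hj, rfl⟩
  · rintro ⟨p, hp, rfl⟩
    exact ⟨p.1, p.2, Nat.le_of_lt_succ p.2.2, hp, rfl⟩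

lemma zmod_two_cases (j : ZMod 2) : j = 0 ∨ j = 1 := by
  revert j
  decide

/-- The parity of i partitions a basis of `R`, and complementary parts of a basis span complementary
subspaces. -/
lemma isCompl_RPart : IsCompl (RPart k 0) (RPart k 1) := by
  rw [RPart_eq_span_image, RPart_eq_span_image]
  constructor
  · refine (linearIndependent_xiFam k).disjoint_span_image (Set.disjoint_left.2 ?_)
    intro p h₀ h₁
    exact zero_ne_one (h₀.symm.trans h₁)
  · rw [codisjoint_iff, ← Submodule.span_union, ← Set.image_union, ← span_range_xiFam,
      ← Set.image_univ]
    congr 2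
    exact Set.eq_univ_of_forall fun p => zmod_two_cases _

instance gradedMonoid_RPart : SetLike.GradedMonoid (RPart k) where
  one_mem := Submodule.subset_span ⟨0, 0, le_rfl, Nat.cast_zero, (xiR_zero_zero k).symm⟩
  mul_mem i j a b ha hb := by
    have h : RPart k i * RPart k j ≤ RPart k (i + j) := by
      rw [RPart, RPart, Submodule.span_mul_span, Submodule.span_le]
      rintro _ ⟨_, ⟨s, i, hi, rfl, rfl⟩, _, ⟨t, j, hj, rfl, rfl⟩, rfl⟩
      exact Submodule.subset_span ⟨s + t, i + j, by omega, Nat.cast_add _ _, xiR_mul_xiR hi hj⟩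
    exact h (Submodule.mul_mem_mul ha hb)

lemma nonempty_gradedAlgebra_RPart : Nonempty (GradedAlgebra (RPart k)) := by
  have h : DirectSum.IsInternal (RPart k) := by
    refine (DirectSum.isInternal_submodule_iff_isCompl _ zero_ne_one ?_).2 (isCompl_RPart k)
    exact (Set.eq_univ_of_forall zmod_two_cases).symm
  exact ⟨{ gradedMonoid_RPart k, h.chooseDecomposition with }⟩

lemma toSubmodule_RZero : Subalgebra.toSubmodule (RZero k) = RPart k 0 := by
  rw [RZero, RPart]
  simp only [ZMod.natCast_eq_zero_iff_even]
  refine Algebra.toSubmodule_adjoin_eq_span ⟨0, 0, le_rfl, Even.zero, (xiR_zero_zero k).symm⟩ ?_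
  rintro _ ⟨s, i, hi, hi', rfl⟩ _ ⟨t, j, hj, hj', rfl⟩
  exact ⟨s + t, i + j, by omega, hi'.add hj', xiR_mul_xiR hi hj⟩

/-- The algebra map `k[z_0, z_1] → R` with `z_0 ↦ ξ_0^2`, `z_1 ↦ ξ_2^2`. -/
def polyHom : MvPolynomial (Fin 2) k →ₐ[k] R k :=
  -- Polynomials are the monoid algebra on exponents, so a multiplicative map on monomials suffices.
  -- By the table, z_0^a z_1^b must go to ξ_{2b}^{2(a+b)}.
  AddMonoidAlgebra.lift k (R k) (Fin 2 →₀ ℕ)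
    { toFun m := xiR k (m.toAdd 0 + m.toAdd 1) (2 * m.toAdd 1) (by omega)
      map_one' := xiR_zero_zero k
      map_mul' m n := by
        rw [xiR_mul_xiR]
        refine xiR_congr _ ?_ ?_ <;> simp <;> ring }

lemma polyHom_monomial (m : Fin 2 →₀ ℕ) :
    polyHom k (MvPolynomial.monomial m 1) = xiR k (m 0 + m 1) (2 * m 1) (by omega) :=
  (AddMonoidAlgebra.lift_single _ _ _).trans (one_smul _ _)

/-- The exponents (a, b) are recovered from (a + b, 2b), so distinct monomials go to distinct
members of an independent family. -/
lemma polyHom_injective : Function.Injective (polyHom k) := by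
  refine LinearMap.injective_of_linearIndependent (f := (polyHom k).toLinearMap)
    (MvPolynomial.basisMonomials (Fin 2) k).span_eq ?_
  have h : Function.Injective fun m : Fin 2 →₀ ℕ =>
      (⟨m 0 + m 1, ⟨2 * m 1, by omega⟩⟩ : Σ t : ℕ, Fin (2 * t + 1)) := by
    intro m n hmn
    have h₁ := congrArg (fun p : Σ t : ℕ, Fin (2 * t + 1) => p.1) hmn
    have h₂ := congrArg (fun p : Σ t : ℕ, Fin (2 * t + 1) => (p.2 : ℕ)) hmn
    ext i
    fin_cases i
    · simp at h₁ h₂ ⊢; omega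
    · simpa using h₂
  have e : (polyHom k).toLinearMap ∘ MvPolynomial.basisMonomials (Fin 2) k =
      xiFam k ∘ fun m => ⟨m 0 + m 1, ⟨2 * m 1, by omega⟩⟩ := by
    funext m
    simpa using! polyHom_monomial k m
  rw [e]
  exact (linearIndependent_xiFam k).comp _ h

lemma range_polyHom : (polyHom k).range = RZero k := by
  apply Subalgebra.toSubmodule_injective
  rw [toSubmodule_RZero]
  have h := (MvPolynomial.basisMonomials (Fin 2) k).span_eq
  change LinearMap.range (polyHom k).toLinearMap = _
  rw [← Submodule.map_top, ← h, Submodule.map_span, ← Set.range_comp, RPart]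
  congr 1
  ext z
  constructor
  · rintro ⟨m, rfl⟩
    refine ⟨m 0 + m 1, 2 * m 1, by omega, ?_, by simpa using! polyHom_monomial k m⟩
    exact ZMod.natCast_eq_zero_iff_even.2 (even_two_mul _)
  · rintro ⟨t, i, hi, hi', rfl⟩
    obtain ⟨j, rfl⟩ := (ZMod.natCast_eq_zero_iff_even.1 hi').exists_two_nsmul
    -- ξ_{2j}^{2t} is the image of z_0^{t-j} z_1^j; the subtraction is exact because 2j ≤ 2t.
    refine ⟨Finsupp.single 0 (t - j) + Finsupp.single 1 j, ?_⟩
    simp only [smul_eq_mul] at hi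
    simp only [Function.comp_apply, MvPolynomial.coe_basisMonomials, AlgHom.toLinearMap_apply]
    refine (polyHom_monomial k _).trans (xiR_congr _ ?_ ?_)
    · simp; omega
    · simp

lemma exists_algEquiv_RZero : ∃ e : MvPolynomial (Fin 2) k ≃ₐ[k] RZero k,
    (e (MvPolynomial.X 0) : R k) = xiR k 1 0 (by norm_num) ∧
    (e (MvPolynomial.X 1) : R k) = xiR k 1 2 (by norm_num) := by
  refine ⟨(AlgEquiv.ofInjective _ (polyHom_injective k)).trans
    (Subalgebra.equivOfEq _ _ (range_polyHom k)), ?_, ?_⟩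
  · refine (polyHom_monomial k _).trans (xiR_congr _ ?_ ?_) <;> simp
  · refine (polyHom_monomial k _).trans (xiR_congr _ ?_ ?_) <;> simp

lemma RPart_one_eq_map : RPart k 1 =
    (RPart k 0).map (LinearMap.mulRight k (xiR k 1 1 (by norm_num))) := by
  rw [RPart, RPart, Submodule.map_span]
  congr 1
  ext z
  constructor
  · rintro ⟨t, i, hi, hi', rfl⟩
    obtain ⟨j, rfl⟩ := ZMod.natCast_eq_one_iff_odd.1 hi'
    -- An odd index 2j + 1 ≤ 2t forces t ≥ 1 and 2j ≤ 2(t - 1), so a factor ξ_1^2 splits off.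
    obtain ⟨s, rfl⟩ : ∃ s, t = s + 1 := ⟨t - 1, by omega⟩
    exact ⟨_, ⟨s, 2 * j, by omega, ZMod.natCast_eq_zero_iff_even.2 (even_two_mul _), rfl⟩,
      xiR_mul_xiR _ _⟩
  · rintro ⟨_, ⟨t, i, hi, hi', rfl⟩, rfl⟩
    exact ⟨t + 1, i + 1, by omega, by rw [Nat.cast_add, hi', Nat.cast_one, zero_add],
      xiR_mul_xiR _ _⟩

end HochschildCohomology

end

open HochschildCohomology
theorem theorem4p2 (k : Type u) [Field k] (hk : ringChar k ≠ 2) :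
    Subalgebra.toSubmodule (R k) ≤ HHEven k (Alg k) ∧
    Nonempty (GradedAlgebra (RPart k)) ∧
    Subalgebra.toSubmodule (RZero k) = RPart k 0 ∧
    (∃ e : MvPolynomial (Fin 2) k ≃ₐ[k] RZero k,
      (e (MvPolynomial.X 0) : R k) = xiR k 1 0 (by norm_num) ∧
      (e (MvPolynomial.X 1) : R k) = xiR k 1 2 (by norm_num)) ∧
    RPart k 1 = (RPart k 0).map (LinearMap.mulRight k (xiR k 1 1 (by norm_num))) ∧
    xiR k 1 1 (by norm_num) * xiR k 1 1 (by norm_num) = xiR k 2 2 (by norm_num) :=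
  ⟨R_le_HHEven k, nonempty_gradedAlgebra_RPart k, toSubmodule_RZero k, exists_algEquiv_RZero k,
    RPart_one_eq_map k, xiR_mul_xiR _ _⟩
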